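/- Let $p4mm$ be the symmetry group of the square lattice, i.e. the group of maps $r\mapsto Ar+b$ of $\mathbb{R}^2$ with $A$ an orthogonal integer matrix and $b\in\mathbb{Z}^2$, and let $T_x,T_y$ be the unit translations, $P_x:(x,y)\mapsto(-x,y)$, $P_{xy}:(x,y)\mapsto(y,x)$. For $G=\mathrm{U}(1)\times p4mm$ the twist is $t(g)=\det A\in\{\pm1\}$, so $t(T_x)=t(T_y)=1$, $t(P_x)=t(P_{xy})=-1$. For an abelian group $M$, let $Z^2_t(p4mm,M)$ be the group of factor sets $\omega:p4mm\times p4mm\to M$ with $\omega(g,h)\,\omega(gh,k)=\omega(g,hk)\,\omega(h,k)^{t(g)}$, let $B^2_t$ be the subgroup of those of the form $\lambda(g)\lambda(h)^{t(g)}\lambda(gh)^{-1}$, and let $H^2_t=Z^2_t/B^2_t$; for $M=\mathrm{U}(1)$ give $H^2_t$ the quotient of the topology of pointwise convergence. Write $H^2$ for trivial $t$. View $\mathbb{Z}_k$ as the group of $k$-th roots of unity in $\mathrm{U}(1)$, so $\mathbb{Z}_2=\{\pm1\}$. Let $\rho_2:H^2(p4mm,\mathbb{Z}_2)\to H^2_t(p4mm,\mathrm{U}(1))$,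 $[\omega]_{\mathbb{Z}_2}\mapsto[\omega]_{\mathrm{U}(1)}$. A class in $H^2(p4mm,\mathbb{Z}_2)$ is anomaly-negative if, for a representative $\omega$, for every even $n\ge 2$ there is $\phi_n\in Z^2_t(p4mm,\mathbb{Z}_{2n})$ with $\omega=\phi_n^{\,n}$; let $\mathcal N$ be the subgroup of these classes and $\mathcal S=H^2(p4mm,\mathbb{Z}_2)/\mathcal N$. Let $E_\omega$ be the extension of $p4mm$ by $M$ defined by $\omega$, and for lifts $X,Y,P,Q\in E_\omega$ of $T_x,T_y,P_x,P_{xy}$ with $Y=QXQ$ consider the relations $$XYX^{-1}Y^{-1}=s_{txty},\quad YPY^{-1}P=s_{typx},\quad P^2=s_{px},\quad XPXP=s_{txpx},\quad Q^2=s_{pxy},\quad (PQ)^4=s_{pxpxy}$$ with $s$'s in $M$. 1. $H^2(p4mm,\mathbb{Z}_2)\cong\mathbb{Z}_2^6$, by an isomorphism $[\omega]\mapsto(\sigma_{txty},\sigma_{typx},\sigma_{px},\sigma_{txpx},\sigma_{pxy},\sigma_{pxpxy})$ whose value is the unique tuple $s$ for which some such lifts to $E_\omega$ exist. 2. $H^2_t(p4mm,\mathrm{U}(1))\cong\mathrm{U}(1)\times\mathbb{Z}_2^3$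 as topological groups, by an isomorphism $[\omega]\mapsto(\alpha_{txty},\alpha_{px},\alpha_{txpx},\alpha_{pxy})$ whose value is the unique element of $\mathrm{U}(1)\times\mathbb{Z}_2^3$ for which some such lifts to $E_\omega$ satisfy the relations with $s_{txty}=\alpha_{txty}$, $s_{px}=\alpha_{px}$, $s_{txpx}=\alpha_{txpx}$, $s_{pxy}=\alpha_{pxy}$ and $s_{typx}=s_{pxpxy}=1$. 3. In these coordinates $\rho_2$ is the projection $(\sigma_{txty},\sigma_{typx},\sigma_{px},\sigma_{txpx},\sigma_{pxy},\sigma_{pxpxy})\mapsto(\sigma_{txty},\sigma_{px},\sigma_{txpx},\sigma_{pxy})$. 4. A class $c\in H^2(p4mm,\mathbb{Z}_2)$ lies in $\mathcal N$ if and only if $\sigma_{px}=\sigma_{txpx}=\sigma_{pxy}=1$, and also if and only if $\rho_2(c)$ lies in the connected component of the identity of $H^2_t(p4mm,\mathrm{U}(1))$. Hence $\mathcal N\cong\mathbb{Z}_2^3$ and $\mathcal S\cong\mathbb{Z}_2^3$. -/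

import Mathlib

namespace FluxFusion

noncomputable section

open groupCohomology

/-! ### Twisted second cohomology through factor sets -/

section Cohomology

variable {G : Type*} [Group G]

/-- The action `g • a = a ^ t(g)` of `G` on an abelian group `M`, for `t : G → {±1}`. -/
abbrev twistAction (t : G →* ℤˣ) (M : Type*) [CommGroup M] : MulDistribMulAction G M where
  smul g a := a ^ ((t g : ℤˣ) : ℤ)
  one_smul a := by
    change a ^ ((t 1 : ℤˣ) : ℤ) = a
    simp
  mul_smul g h a := by
    change a ^ ((t (g * h) : ℤˣ) : ℤ) = (a ^ ((t h : ℤˣ) : ℤ)) ^ ((t g : ℤˣ) : ℤ)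
    rw [map_mul, Units.val_mul, mul_comm, zpow_mul]
  smul_mul g a b := mul_zpow a b _
  smul_one g := one_zpow _

/-- `Z²_t(G, M)`: the group of `t`-twisted `M`-valued factor sets on `G`
(Mathlib's multiplicative 2-cocycles for the twisted action). -/
def factorSets (t : G →* ℤˣ) (M : Type*) [CommGroup M] : Subgroup (G × G → M) where
  carrier := {ω | letI := twistAction t M; IsMulCocycle₂ ω}
  one_mem' := fun g h k => by
    change (1 : M) * 1 = (1 : M) ^ ((t g : ℤˣ) : ℤ) * 1
    simp
  mul_mem' := fun {a b} ha hb g h k => by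
    have h1 : a (g * h, k) * a (g, h) = a (h, k) ^ ((t g : ℤˣ) : ℤ) * a (g, h * k) := ha g h k
    have h2 : b (g * h, k) * b (g, h) = b (h, k) ^ ((t g : ℤˣ) : ℤ) * b (g, h * k) := hb g h k
    change a (g * h, k) * b (g * h, k) * (a (g, h) * b (g, h)) =
      (a (h, k) * b (h, k)) ^ ((t g : ℤˣ) : ℤ) * (a (g, h * k) * b (g, h * k))
    rw [mul_mul_mul_comm, h1, h2, mul_zpow, mul_mul_mul_comm]
  inv_mem' := fun {a} ha g h k => by
    have h1 : a (g * h, k) * a (g, h) = a (h, k) ^ ((t g : ℤˣ) : ℤ) * a (g, h * k) := ha g h k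
    change (a (g * h, k))⁻¹ * (a (g, h))⁻¹ =
      ((a (h, k))⁻¹) ^ ((t g : ℤˣ) : ℤ) * (a (g, h * k))⁻¹
    rw [inv_zpow, ← mul_inv, ← mul_inv, h1]

/-- The factor set condition written out. -/
theorem mem_factorSets {t : G →* ℤˣ} {M : Type*} [CommGroup M] {ω : G × G → M} :
    ω ∈ factorSets t M ↔ ∀ g h k : G,
      ω (g, h) * ω (g * h, k) = ω (g, h * k) * ω (h, k) ^ ((t g : ℤˣ) : ℤ) := by
  refine forall_congr' fun g => forall_congr' fun h => forall_congr' fun k => ?_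
  change ω (g * h, k) * ω (g, h) = ω (h, k) ^ ((t g : ℤˣ) : ℤ) * ω (g, h * k) ↔ _
  rw [mul_comm (ω (g * h, k)), mul_comm (ω (h, k) ^ _)]

/-- `B²_t(G, M)`: the factor sets `λ(g) λ(h)^{t(g)} λ(gh)⁻¹`
(Mathlib's multiplicative 2-coboundaries for the twisted action). -/
def coboundaries (t : G →* ℤˣ) (M : Type*) [CommGroup M] : Subgroup (G × G → M) where
  carrier := {ω | letI := twistAction t M; IsMulCoboundary₂ ω}
  one_mem' := ⟨1, fun g h => by
    change (1 : M) ^ ((t g : ℤˣ) : ℤ) / 1 * 1 = 1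
    simp⟩
  mul_mem' := by
    rintro a b ⟨x, hx⟩ ⟨y, hy⟩
    refine ⟨x * y, fun g h => ?_⟩
    have h1 : x h ^ ((t g : ℤˣ) : ℤ) / x (g * h) * x g = a (g, h) := hx g h
    have h2 : y h ^ ((t g : ℤˣ) : ℤ) / y (g * h) * y g = b (g, h) := hy g h
    change (x h * y h) ^ ((t g : ℤˣ) : ℤ) / (x (g * h) * y (g * h)) * (x g * y g) =
      a (g, h) * b (g, h)
    rw [← h1, ← h2, mul_zpow, mul_div_mul_comm, mul_mul_mul_comm]
  inv_mem' := by
    rintro a ⟨x, hx⟩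
    refine ⟨x⁻¹, fun g h => ?_⟩
    have h1 : x h ^ ((t g : ℤˣ) : ℤ) / x (g * h) * x g = a (g, h) := hx g h
    change ((x h)⁻¹) ^ ((t g : ℤˣ) : ℤ) / (x (g * h))⁻¹ * (x g)⁻¹ = (a (g, h))⁻¹
    rw [← h1, inv_zpow, mul_inv, inv_div_inv, inv_div]

/-- The coboundary condition written out. -/
theorem mem_coboundaries {t : G →* ℤˣ} {M : Type*} [CommGroup M] {ω : G × G → M} :
    ω ∈ coboundaries t M ↔ ∃ l : G → M, ∀ g h : G,
      ω (g, h) = l g * l h ^ ((t g : ℤˣ) : ℤ) * (l (g * h))⁻¹ := by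
  refine exists_congr fun l => forall_congr' fun g => forall_congr' fun h => ?_
  change l h ^ ((t g : ℤˣ) : ℤ) / l (g * h) * l g = ω (g, h) ↔ _
  rw [eq_comm, div_eq_mul_inv, mul_comm, mul_assoc]

/-- `H²_t(G, M) = Z²_t(G, M) / B²_t(G, M)`. For a topological group `M` it carries the quotient of
the topology of pointwise convergence of factor sets. -/
abbrev H2 (t : G →* ℤˣ) (M : Type*) [CommGroup M] : Type _ :=
  factorSets t M ⧸ (coboundaries t M).subgroupOf (factorSets t M)

/-- The class `[ω]` of a factor set. -/
def cls {t : G →* ℤˣ} {M : Type*} [CommGroup M] : factorSets t M →* H2 t M :=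
  QuotientGroup.mk' _

/-! ### The extension defined by a factor set -/

/-- The extension `E_ω` of `G` by `M`: pairs `(a, g)` with
`(a, g) (b, h) = (a b^{t(g)} ω(g, h), g h)`. -/
@[ext]
structure Extension {t : G →* ℤˣ} {M : Type*} [CommGroup M] (ω : factorSets t M) where
  /-- the coefficient -/
  phase : M
  /-- the image under the projection to `G` -/
  base : G

namespace Extension

variable {t : G →* ℤˣ} {M : Type*} [CommGroup M] {ω : factorSets t M}

instance : Mul (Extension ω) :=
  ⟨fun x y => ⟨x.phase * y.phase ^ ((t x.base : ℤˣ) : ℤ) * ω.1 (x.base, y.base), x.base * y.base⟩⟩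

instance : One (Extension ω) := ⟨⟨(ω.1 (1, 1))⁻¹, 1⟩⟩

instance : Inv (Extension ω) :=
  ⟨fun x => ⟨(ω.1 (1, 1))⁻¹ * (ω.1 (x.base⁻¹, x.base))⁻¹ *
    (x.phase ^ ((t x.base⁻¹ : ℤˣ) : ℤ))⁻¹, x.base⁻¹⟩⟩

instance : Group (Extension ω) :=
  Group.ofLeftAxioms
    (fun x y z => by
      have h := mem_factorSets.1 ω.2 x.base y.base z.base
      ext
      · change x.phase * y.phase ^ ((t x.base : ℤˣ) : ℤ) * ω.1 (x.base, y.base) *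
            z.phase ^ ((t (x.base * y.base) : ℤˣ) : ℤ) * ω.1 (x.base * y.base, z.base) =
          x.phase * (y.phase * z.phase ^ ((t y.base : ℤˣ) : ℤ) *
            ω.1 (y.base, z.base)) ^ ((t x.base : ℤˣ) : ℤ) * ω.1 (x.base, y.base * z.base)
        rw [mul_zpow, mul_zpow, ← zpow_mul, map_mul, Units.val_mul,
          mul_comm ((t y.base : ℤˣ) : ℤ)]
        calc _ = x.phase * y.phase ^ ((t x.base : ℤˣ) : ℤ) *
              z.phase ^ (((t x.base : ℤˣ) : ℤ) * ((t y.base : ℤˣ) : ℤ)) *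
              (ω.1 (x.base, y.base) * ω.1 (x.base * y.base, z.base)) := by ac_rfl
          _ = _ := by rw [h]; ac_rfl
      · exact mul_assoc x.base y.base z.base)
    (fun x => by
      have h := mem_factorSets.1 ω.2 1 1 x.base
      ext
      · change (ω.1 (1, 1))⁻¹ * x.phase ^ ((t 1 : ℤˣ) : ℤ) * ω.1 (1, x.base) = x.phase
        simp only [map_one, Units.val_one, zpow_one, one_mul, mul_one] at h ⊢
        have h' : ω.1 (1, 1) = ω.1 (1, x.base) := mul_right_cancel h
        rw [h', mul_comm, mul_inv_cancel_left]
      · exact one_mul x.base)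
    (fun x => by
      ext
      · change (ω.1 (1, 1))⁻¹ * (ω.1 (x.base⁻¹, x.base))⁻¹ *
          (x.phase ^ ((t x.base⁻¹ : ℤˣ) : ℤ))⁻¹ * x.phase ^ ((t x.base⁻¹ : ℤˣ) : ℤ) *
          ω.1 (x.base⁻¹, x.base) = (ω.1 (1, 1))⁻¹
        simp
      · exact inv_mul_cancel x.base)

/-- The inclusion `a ↦ (a ω(1,1)⁻¹, 1)` of `M` into `E_ω`. -/
def inl (ω : factorSets t M) : M →* Extension ω where
  toFun a := ⟨a * (ω.1 (1, 1))⁻¹, 1⟩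
  map_one' := by
    ext
    · exact one_mul _
    · rfl
  map_mul' a b := by
    ext
    · change a * b * (ω.1 (1, 1))⁻¹ =
        a * (ω.1 (1, 1))⁻¹ * (b * (ω.1 (1, 1))⁻¹) ^ ((t 1 : ℤˣ) : ℤ) * ω.1 (1, 1)
      simp only [map_one, Units.val_one, zpow_one]
      rw [← mul_assoc, inv_mul_cancel_right, mul_right_comm]
    · exact (one_mul (1 : G)).symm

/-- The projection `(a, g) ↦ g` of `E_ω` onto `G`. -/
def proj (ω : factorSets t M) : Extension ω →* G where
  toFun := base
  map_one' := rfl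
  map_mul' _ _ := rfl

end Extension

/-! ### Finite coefficients, the map `ρ₂` and the anomaly test -/

/-- The cyclic subgroup `ℤ_k ⊂ U(1)` of `k`-th roots of unity. -/
abbrev Zmod (k : ℕ) : Subgroup Circle := (powMonoidHom k : Circle →* Circle).ker

/-- `ℤ₂ = {1, -1} ⊂ U(1)`. -/
abbrev Z2 : Subgroup Circle := Zmod 2

/-- A factor set with values in `ℤ₂` (untwisted) viewed as a `t`-twisted `U(1)` factor set. -/
def inclZ2 (t : G →* ℤˣ) : factorSets (1 : G →* ℤˣ) Z2 →* factorSets t Circle where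
  toFun ω := ⟨fun p => (ω.1 p : Circle), mem_factorSets.2 fun g h k => by
    have h1 := congrArg (Subtype.val : Z2 → Circle) (mem_factorSets.1 ω.2 g h k)
    have h2 : (ω.1 (h, k) : Circle) ^ 2 = 1 := (ω.1 (h, k)).2
    have h3 : (ω.1 (h, k) : Circle)⁻¹ = (ω.1 (h, k) : Circle) := by
      rw [inv_eq_iff_mul_eq_one, ← sq, h2]
    rcases Int.units_eq_one_or (t g) with ht | ht <;> simpa [ht, h3] using h1⟩
  map_one' := rfl
  map_mul' _ _ := rfl

/-- `ρ₂ : H²(G, ℤ₂) → H²_t(G, U(1))`, `[ω]_{ℤ₂} ↦ [ω]_{U(1)}`. -/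
def rho2 (t : G →* ℤˣ) : H2 (1 : G →* ℤˣ) Z2 →* H2 t Circle :=
  QuotientGroup.map _ _ (inclZ2 t) (by
    intro ω hω
    obtain ⟨l, hl⟩ := mem_coboundaries.1 (Subgroup.mem_subgroupOf.1 hω)
    refine Subgroup.mem_subgroupOf.2 (mem_coboundaries.2 ⟨fun g => (l g : Circle), fun g h => ?_⟩)
    have h1 := congrArg (Subtype.val : Z2 → Circle) (hl g h)
    have h2 : (l h : Circle) ^ 2 = 1 := (l h).2
    have h3 : (l h : Circle)⁻¹ = (l h : Circle) := by
      rw [inv_eq_iff_mul_eq_one, ← sq, h2]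
    change (ω.1 (g, h) : Circle) = _
    rcases Int.units_eq_one_or (t g) with ht | ht <;> simpa [ht, h3] using h1)

/-- The factor sets `ω` with values in `ℤ₂` that pass the flux-fusion anomaly test: for every even
`n ≥ 2` there is a `t`-twisted `ℤ_{2n}` factor set `φ` with `ω = φ^n`. -/
def anomalyNegativeFactorSets (t : G →* ℤˣ) : Subgroup (factorSets (1 : G →* ℤˣ) Z2) where
  carrier := {ω | ∀ n : ℕ, 2 ≤ n → Even n → ∃ φ : factorSets t (Zmod (2 * n)),
    ∀ p : G × G, (ω.1 p : Circle) = (φ.1 p : Circle) ^ n}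
  one_mem' := fun n _ _ => ⟨1, fun p => (one_pow n).symm⟩
  mul_mem' := fun {a b} ha hb n hn he => by
    obtain ⟨φ, hφ⟩ := ha n hn he
    obtain ⟨ψ, hψ⟩ := hb n hn he
    refine ⟨φ * ψ, fun p => ?_⟩
    change (a.1 p : Circle) * (b.1 p : Circle) = ((φ.1 p : Circle) * (ψ.1 p : Circle)) ^ n
    rw [mul_pow, hφ, hψ]
  inv_mem' := fun {a} ha n hn he => by
    obtain ⟨φ, hφ⟩ := ha n hn he
    refine ⟨φ⁻¹, fun p => ?_⟩
    change (a.1 p : Circle)⁻¹ = ((φ.1 p : Circle)⁻¹) ^ n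
    rw [inv_pow, hφ]

/-- The group `𝒩 ⊂ H²(G, ℤ₂)` of anomaly-negative fractionalization classes. -/
def anomalyNegative (t : G →* ℤˣ) : Subgroup (H2 (1 : G →* ℤˣ) Z2) :=
  (anomalyNegativeFactorSets t).map cls

end Cohomology

/-! ### The group `p4mm` -/

open Matrix

attribute [local instance] starRingOfComm

/-- The symmetry group of the square lattice `ℤ²`: the maps `r ↦ A r + b` with `A` an orthogonal
matrix with integer entries and `b ∈ ℤ²`. -/
@[ext]
structure P4mm where
  /-- the linear part `A` -/
  lin : orthogonalGroup (Fin 2) ℤ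
  /-- the translation part `b` -/
  trans : Fin 2 → ℤ

namespace P4mm

/-- Composition of maps. -/
instance : Mul P4mm := ⟨fun g h => ⟨g.lin * h.lin, g.lin.1 *ᵥ h.trans + g.trans⟩⟩

instance : One P4mm := ⟨⟨1, 0⟩⟩

instance : Inv P4mm := ⟨fun g => ⟨g.lin⁻¹, -((g.lin⁻¹).1 *ᵥ g.trans)⟩⟩

instance : Group P4mm :=
  Group.ofLeftAxioms
    (fun x y z => by
      refine P4mm.ext (mul_assoc _ _ _) ?_
      change (x.lin.1 * y.lin.1) *ᵥ z.trans + (x.lin.1 *ᵥ y.trans + x.trans) =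
        x.lin.1 *ᵥ (y.lin.1 *ᵥ z.trans + y.trans) + x.trans
      rw [mulVec_add, mulVec_mulVec, add_assoc])
    (fun x => by
      refine P4mm.ext (one_mul _) ?_
      change (1 : Matrix (Fin 2) (Fin 2) ℤ) *ᵥ x.trans + 0 = x.trans
      rw [one_mulVec, add_zero])
    (fun x => by
      refine P4mm.ext (inv_mul_cancel _) ?_
      exact add_neg_cancel _)

/-- `t(g) = det A`: it is `-1` on orientation-reversing elements, `1` on the others. -/
def twist : P4mm →* ℤˣ where
  toFun g := Units.map (Matrix.detMonoidHom : Matrix (Fin 2) (Fin 2) ℤ →* ℤ)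
    (Unitary.toUnits g.lin)
  map_one' := by
    change Units.map _ (Unitary.toUnits 1) = 1
    rw [map_one, map_one]
  map_mul' g h := by
    change Units.map _ (Unitary.toUnits (g.lin * h.lin)) = _
    rw [map_mul, map_mul]

/-- `(x, y) ↦ (x + 1, y)` -/
def Tx : P4mm := ⟨1, ![1, 0]⟩

/-- `(x, y) ↦ (x, y + 1)` -/
def Ty : P4mm := ⟨1, ![0, 1]⟩

/-- `(x, y) ↦ (-x, y)` -/
def Px : P4mm := ⟨⟨!![-1, 0; 0, 1], mem_orthogonalGroup_iff _ _ |>.2 (by decide)⟩, 0⟩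

/-- `(x, y) ↦ (y, x)` -/
def Pxy : P4mm := ⟨⟨!![0, 1; 1, 0], mem_orthogonalGroup_iff _ _ |>.2 (by decide)⟩, 0⟩

/-- The six relations of `p4mm` whose right-hand sides parametrize factor sets. -/
inductive Rel
  | txty | typx | px | txpx | pxy | pxpxy

/-- Some lifts of `Tx, Ty, Px, Pxy` to the extension defined by `ω` satisfy the relations of `p4mm`
up to the coefficients `s`, and the relation `Ty = Pxy Tx Pxy` exactly. -/
def HasRelations {t : P4mm →* ℤˣ} {M : Type*} [CommGroup M] (ω : factorSets t M)
    (s : Rel → M) : Prop :=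
  ∃ X Y P Q : Extension ω,
    Extension.proj ω X = Tx ∧ Extension.proj ω Y = Ty ∧
    Extension.proj ω P = Px ∧ Extension.proj ω Q = Pxy ∧
    X * Y * X⁻¹ * Y⁻¹ = Extension.inl ω (s .txty) ∧
    Y * P * Y⁻¹ * P = Extension.inl ω (s .typx) ∧
    Y = Q * X * Q ∧
    P ^ 2 = Extension.inl ω (s .px) ∧
    X * P * X * P = Extension.inl ω (s .txpx) ∧
    Q ^ 2 = Extension.inl ω (s .pxy) ∧
    (P * Q) ^ 4 = Extension.inl ω (s .pxpxy)

/-- The canonical form of the coefficients over `U(1)`: `typx` and `pxpxy` are set to `1`. -/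
def canonical (txty : Circle) (px txpx pxy : Z2) : Rel → Circle
  | .txty => txty
  | .typx => 1
  | .px => px
  | .txpx => txpx
  | .pxy => pxy
  | .pxpxy => 1

end P4mm

end

end FluxFusion

/-!
The group `p4mm` is generated by `T_x`, `T_y`, `P_x`, `P_xy`, and the relations in `HasRelations`
with all coefficients equal to `1` are a presentation of it. Both computations of second cohomology
come from this presentation.

*Invariants.* Let reflections act on the coefficients by inversion; for `ℤ₂` this is the trivial
action. Changing the phases of the lifts does not affect the coefficients of `txty`, `px`, `txpx`
and `pxy`, so they are explicit products of values of the factor set, whereas `typx` is multiplied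
by an arbitrary square and `pxpxy` by an arbitrary fourth power (`hasRelations_iff`). Over `ℤ₂`
these powers are trivial and six invariants are left (`signInvariants`). Over `U(1)` both
coefficients can be normalized to `1` and four invariants are left (`circleInvariants`). In this
form the invariants are visibly multiplicative and continuous, and compatible with `ρ₂`.

*Injectivity.* If all coefficients are `1`, the extension splits. In the subgroup generated by the
lifts every element has the form `X^a Y^b P^i R^j Q^k` with `R = Q P Q` (`exists_normalForm`), and
the parities of `i, j, k` and the integers `a, b` can be read off from the image in `p4mm`. So the
projection is bijective on this subgroup, and its inverse is a section
(`mem_coboundaries_of_hasRelations_one`).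

*Surjectivity.* Each invariant is realized by a factor set `u ^ f(g, h)` with an integral exponent
`f`. For `px`, `txpx`, `pxy` the exponent is a cup product of two characters to `ℤ/2`. For the other
three it is a twisted factor set with values in `ℤ` itself: half of the area `b_g × A_g b_h` made
integral by a coboundary for `txty`, the coboundary of a half-integral cochain for `typx`, and that
of a quarter-integral cochain for `pxpxy`. Since `u ^ f` is continuous in `u`, the isomorphism with
`U(1) × ℤ₂³` is a homeomorphism.

*Anomaly.* If `ω = φ²` with `φ` a twisted factor set, the `U(1)` invariants of `ω` are squares, so
the three signs `px`, `txpx`, `pxy` are trivial. Conversely, such a class is a product of classes of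
`u ^ f` with `f` an integral twisted factor set, and `u ^ f = (ζ ^ f) ^ n` for any `ζ` with
`ζ ^ n = u`.
-/

namespace FluxFusion

noncomputable section

open scoped Matrix
open Matrix (mem_orthogonalGroup_iff mem_orthogonalGroup_iff' mul_apply)

attribute [local instance] starRingOfComm

namespace P4mm

/-! ### Entries of elements of `p4mm` -/

theorem mul_lin (g h : P4mm) : (g * h).lin.1 = g.lin.1 * h.lin.1 := rfl

theorem mul_trans (g h : P4mm) : (g * h).trans = g.lin.1 *ᵥ h.trans + g.trans := rfl

theorem one_lin : (1 : P4mm).lin.1 = 1 := rfl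

theorem one_trans : (1 : P4mm).trans = 0 := rfl

theorem ext_entries {g h : P4mm} (h00 : g.lin.1 0 0 = h.lin.1 0 0)
    (h01 : g.lin.1 0 1 = h.lin.1 0 1) (h10 : g.lin.1 1 0 = h.lin.1 1 0)
    (h11 : g.lin.1 1 1 = h.lin.1 1 1) (h0 : g.trans 0 = h.trans 0)
    (h1 : g.trans 1 = h.trans 1) : g = h := by
  refine P4mm.ext (Subtype.ext (Matrix.ext fun i j => ?_)) (funext fun i => ?_)
  · fin_cases i <;> fin_cases j <;> assumption
  · fin_cases i <;> assumption

/-- An integer vector of length one is `± e₀` or `± e₁`, so an orthogonal integer matrix is a signed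
permutation matrix. -/
theorem lin_cases (g : P4mm) :
    (g.lin.1 0 1 = 0 ∧ g.lin.1 1 0 = 0 ∧ (g.lin.1 0 0 = 1 ∨ g.lin.1 0 0 = -1) ∧
      (g.lin.1 1 1 = 1 ∨ g.lin.1 1 1 = -1)) ∨
    (g.lin.1 0 0 = 0 ∧ g.lin.1 1 1 = 0 ∧ (g.lin.1 0 1 = 1 ∨ g.lin.1 0 1 = -1) ∧
      (g.lin.1 1 0 = 1 ∨ g.lin.1 1 0 = -1)) := by
  have h := (mem_orthogonalGroup_iff (Fin 2) ℤ).1 g.lin.2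
  have h' := (mem_orthogonalGroup_iff' (Fin 2) ℤ).1 g.lin.2
  have h1 := congrFun (congrFun h 0) 0
  have h2 := congrFun (congrFun h 1) 1
  have h3 := congrFun (congrFun h' 0) 0
  have h4 := congrFun (congrFun h' 1) 1
  simp [mul_apply, Fin.sum_univ_two] at h1 h2 h3 h4
  have sq (a b : ℤ) (hab : a * a + b * b = 1) :
      (b = 0 ∧ (a = 1 ∨ a = -1)) ∨ (a = 0 ∧ (b = 1 ∨ b = -1)) := by
    have ha : a ≤ 1 := by nlinarith [mul_self_nonneg b]
    have ha' : -1 ≤ a := by nlinarith [mul_self_nonneg b]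
    interval_cases a
    · exact Or.inl ⟨by nlinarith, Or.inr rfl⟩
    · exact Or.inr ⟨rfl, mul_self_eq_one_iff.1 (by linarith)⟩
    · exact Or.inl ⟨by nlinarith, Or.inl rfl⟩
  have s1 := sq _ _ h1
  have s2 := sq _ _ h2
  have s3 := sq _ _ h3
  have s4 := sq _ _ h4
  omega

/-! ### The presentation of `p4mm` -/

/-- The words `X^a Y^b P^i R^j Q^k` with `R = Q P Q`, which serve as normal forms for elements
of a group satisfying the relations of `p4mm`. -/
def normalForm {E : Type*} [Group E] (X Y P Q : E) (a b i j k : ℤ) : E :=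
  X ^ a * Y ^ b * P ^ i * (Q * P * Q) ^ j * Q ^ k

theorem map_normalForm {E F : Type*} [Group E] [Group F] (f : E →* F) (X Y P Q : E)
    (a b i j k : ℤ) :
    f (normalForm X Y P Q a b i j k) = normalForm (f X) (f Y) (f P) (f Q) a b i j k := by
  simp [normalForm]

/-- Left multiplication by a generator or its inverse takes normal forms to normal forms. -/
theorem exists_normalForm {E : Type*} [Group E] {X Y P Q : E} (hXY : X * Y * X⁻¹ * Y⁻¹ = 1)
    (hYP : Y * P * Y⁻¹ * P = 1) (hY : Y = Q * X * Q) (hP : P ^ 2 = 1)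
    (hXP : X * P * X * P = 1) (hQ : Q ^ 2 = 1) (hPQ : (P * Q) ^ 4 = 1) {z : E}
    (hz : z ∈ Subgroup.closure {X, Y, P, Q}) :
    ∃ a b i j k : ℤ, z = normalForm X Y P Q a b i j k := by
  have hP' : P⁻¹ = P := by rw [inv_eq_iff_mul_eq_one, ← sq, hP]
  have hQ' : Q⁻¹ = Q := by rw [inv_eq_iff_mul_eq_one, ← sq, hQ]
  have hQQ : Q * Q = 1 := by rw [← sq, hQ]
  have cXY : Commute Y X := by
    rw [mul_inv_eq_one, mul_inv_eq_iff_eq_mul] at hXY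
    exact hXY.symm
  have sPX : SemiconjBy P X X⁻¹ := by
    have h : X * P * X = P⁻¹ := eq_inv_of_mul_eq_one_left hXP
    rw [hP'] at h
    change P * X = X⁻¹ * P
    rw [eq_inv_mul_iff_mul_eq, ← mul_assoc, h]
  have sPY : Commute P Y := by
    have h : Y * P * Y⁻¹ = P⁻¹ := eq_inv_of_mul_eq_one_left hYP
    rw [hP', mul_inv_eq_iff_eq_mul] at h
    exact h.symm
  have sQX : SemiconjBy Q X Y := by
    change Q * X = Y * Q
    rw [hY, mul_assoc (Q * X), hQQ, mul_one]
  have sQY : SemiconjBy Q Y X := by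
    change Q * Y = X * Q
    rw [hY, ← mul_assoc, ← mul_assoc, hQQ, one_mul]
  have sQP : SemiconjBy Q P (Q * P * Q) := by
    change Q * P = Q * P * Q * Q
    rw [mul_assoc (Q * P), hQQ, mul_one]
  have sQR : SemiconjBy Q (Q * P * Q) P := by
    change Q * (Q * P * Q) = P * Q
    rw [← mul_assoc, ← mul_assoc, hQQ, one_mul]
  -- `(P R)² = (P Q)⁴ = 1` for the involutions `P` and `R`.
  have cPR : Commute P (Q * P * Q) := by
    have h : P * (Q * P * Q) * (P * (Q * P * Q)) = 1 := by
      rw [← hPQ]; simp only [pow_succ, pow_zero, one_mul, mul_assoc]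
    have h' := eq_inv_of_mul_eq_one_left h
    rwa [mul_inv_rev, mul_inv_rev, mul_inv_rev, hP', hQ', ← mul_assoc Q P Q] at h'
  have stepX (c a b i j k : ℤ) : X ^ c * normalForm X Y P Q a b i j k =
      normalForm X Y P Q (c + a) b i j k := by
    simp only [normalForm, zpow_add, mul_assoc]
  have stepY (c a b i j k : ℤ) : Y ^ c * normalForm X Y P Q a b i j k =
      normalForm X Y P Q a (c + b) i j k := by
    simp only [normalForm, zpow_add, ← mul_assoc, (cXY.zpow_zpow c a).eq]
  have stepP (a b i j k : ℤ) : P * normalForm X Y P Q a b i j k =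
      normalForm X Y P Q (-a) b (1 + i) j k := by
    simp only [normalForm, zpow_add, zpow_one, ← mul_assoc]
    rw [(sPX.zpow_right a).eq, inv_zpow', mul_assoc (X ^ (-a)), (sPY.zpow_right b).eq]
    simp only [mul_assoc]
  have stepQ (a b i j k : ℤ) : Q * normalForm X Y P Q a b i j k =
      normalForm X Y P Q b a j i (1 + k) := by
    simp only [normalForm, zpow_add, zpow_one]
    rw [← mul_assoc, ((((sQX.zpow_right a).mul_right (sQY.zpow_right b)).mul_right
      (sQP.zpow_right i)).mul_right (sQR.zpow_right j)).eq, (cXY.zpow_zpow a b).eq,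
      mul_assoc (X ^ b * Y ^ a), ((cPR.zpow_zpow j i).eq).symm]
    simp only [mul_assoc]
  induction hz using Subgroup.closure_induction_left with
  | one => exact ⟨0, 0, 0, 0, 0, by simp [normalForm]⟩
  | mul_left x hx y _ ih =>
    obtain ⟨a, b, i, j, k, rfl⟩ := ih
    rcases hx with rfl | rfl | rfl | rfl
    · exact ⟨_, _, _, _, _, by rw [← stepX 1, zpow_one]⟩
    · exact ⟨_, _, _, _, _, by rw [← stepY 1, zpow_one]⟩
    · exact ⟨_, _, _, _, _, stepP ..⟩
    · exact ⟨_, _, _, _, _, stepQ ..⟩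
  | inv_mul_cancel x hx y _ ih =>
    obtain ⟨a, b, i, j, k, rfl⟩ := ih
    rcases hx with rfl | rfl | rfl | rfl
    · exact ⟨_, _, _, _, _, by rw [← stepX (-1), zpow_neg_one]⟩
    · exact ⟨_, _, _, _, _, by rw [← stepY (-1), zpow_neg_one]⟩
    · exact ⟨_, _, _, _, _, by rw [hP', stepP]⟩
    · exact ⟨_, _, _, _, _, by rw [hQ', stepQ]⟩

theorem Tx_zpow (a : ℤ) : Tx ^ a = ⟨1, ![a, 0]⟩ := by
  have h : Tx⁻¹ = ⟨1, ![-1, 0]⟩ := by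
    rw [inv_eq_iff_mul_eq_one]
    exact ext_entries rfl rfl rfl rfl rfl rfl
  induction a using Int.induction_on with
  | zero => exact ext_entries rfl rfl rfl rfl rfl rfl
  | succ n ih =>
    rw [zpow_add_one, ih]
    refine ext_entries ?_ ?_ ?_ ?_ ?_ ?_ <;> simp [mul_lin, mul_trans, Tx, add_comm]
  | pred n ih =>
    rw [zpow_sub_one, ih, h]
    refine ext_entries ?_ ?_ ?_ ?_ ?_ ?_ <;> simp [mul_lin, mul_trans, sub_eq_neg_add]

theorem Ty_zpow (a : ℤ) : Ty ^ a = ⟨1, ![0, a]⟩ := by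
  have h : Ty⁻¹ = ⟨1, ![0, -1]⟩ := by
    rw [inv_eq_iff_mul_eq_one]
    exact ext_entries rfl rfl rfl rfl rfl rfl
  induction a using Int.induction_on with
  | zero => exact ext_entries rfl rfl rfl rfl rfl rfl
  | succ n ih =>
    rw [zpow_add_one, ih]
    refine ext_entries ?_ ?_ ?_ ?_ ?_ ?_ <;> simp [mul_lin, mul_trans, Ty, add_comm]
  | pred n ih =>
    rw [zpow_sub_one, ih, h]
    refine ext_entries ?_ ?_ ?_ ?_ ?_ ?_ <;> simp [mul_lin, mul_trans, sub_eq_neg_add]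

/-- A power of an involution depends on the parity of the exponent only. -/
theorem zpow_eq_ite_even {E : Type*} [Group E] {P : E} (hP : P ^ 2 = 1) (i : ℤ) :
    P ^ i = if Even i then 1 else P := by
  have hP' : P ^ (2 : ℤ) = 1 := by exact_mod_cast hP
  rcases Int.even_or_odd' i with ⟨m, rfl | rfl⟩
  · simp [zpow_mul, hP']
  · rw [zpow_add, zpow_mul, hP', one_zpow, one_mul, zpow_one, if_neg]
    simp

theorem Px_sq : Px ^ 2 = 1 := ext_entries rfl rfl rfl rfl rfl rfl

theorem Pxy_sq : Pxy ^ 2 = 1 := ext_entries rfl rfl rfl rfl rfl rfl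

theorem Py_sq : (Pxy * Px * Pxy) ^ 2 = 1 := ext_entries rfl rfl rfl rfl rfl rfl

theorem normalForm_eq (a b i j k : ℤ) :
    normalForm Tx Ty Px Pxy a b i j k = ⟨1, ![a, b]⟩ * ((if Even i then 1 else Px) *
      (if Even j then 1 else Pxy * Px * Pxy) * (if Even k then 1 else Pxy)) := by
  rw [normalForm, zpow_eq_ite_even Px_sq, zpow_eq_ite_even Py_sq, zpow_eq_ite_even Pxy_sq,
    Tx_zpow, Ty_zpow]
  have h : (⟨1, ![a, 0]⟩ : P4mm) * ⟨1, ![0, b]⟩ = ⟨1, ![a, b]⟩ := by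
    refine ext_entries ?_ ?_ ?_ ?_ ?_ ?_ <;> simp [mul_lin, mul_trans]
  rw [h, mul_assoc, mul_assoc, mul_assoc (ite _ _ _)]

theorem eq_normalForm (g : P4mm) :
    ∃ a b i j k : ℤ, g = normalForm Tx Ty Px Pxy a b i j k := by
  -- The exponents `i`, `j` record the signs of the nonzero entries of the two rows of `A`, and `k`
  -- whether `A` is antidiagonal.
  refine ⟨g.trans 0, g.trans 1, if g.lin.1 0 0 + g.lin.1 0 1 = 1 then 0 else 1,
    if g.lin.1 1 0 + g.lin.1 1 1 = 1 then 0 else 1, if g.lin.1 0 1 = 0 then 0 else 1, ?_⟩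
  rw [normalForm_eq]
  rcases lin_cases g with ⟨h01, h10, h00 | h00, h11 | h11⟩ | ⟨h00, h11, h01 | h01, h10 | h10⟩ <;>
    rw [h00, h01, h10, h11] <;>
    refine ext_entries ?_ ?_ ?_ ?_ ?_ ?_ <;>
    simp [mul_lin, mul_trans, Px, Pxy, h00, h01, h10, h11]

theorem normalForm_eq_one {a b i j k : ℤ} (h : normalForm Tx Ty Px Pxy a b i j k = 1) :
    a = 0 ∧ b = 0 ∧ Even i ∧ Even j ∧ Even k := by
  rw [normalForm_eq] at h
  -- Two diagonal entries of the linear part suffice to exclude every odd exponent.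
  by_cases hi : Even i <;> by_cases hj : Even j <;> by_cases hk : Even k <;>
    simp only [hi, hj, hk, if_true, if_false] at h <;>
    have h0 := congrArg (fun g : P4mm => g.trans 0) h <;>
    have h1 := congrArg (fun g : P4mm => g.trans 1) h <;>
    have h00 := congrArg (fun g : P4mm => g.lin.1 0 0) h <;>
    have h11 := congrArg (fun g : P4mm => g.lin.1 1 1) h <;>
    clear h <;>
    simp [mul_lin, mul_trans, one_lin, one_trans, Px, Pxy] at h0 h1 h00 h11
  exact ⟨h0, h1, hi, hj, hk⟩

/-- A section of an extension of `p4mm`, built from lifts of the generators that satisfy the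
relations: on the subgroup generated by the lifts, the projection is bijective. -/
theorem exists_section {E : Type*} [Group E] (f : E →* P4mm) {X Y P Q : E} (fX : f X = Tx)
    (fY : f Y = Ty) (fP : f P = Px) (fQ : f Q = Pxy) (hXY : X * Y * X⁻¹ * Y⁻¹ = 1)
    (hYP : Y * P * Y⁻¹ * P = 1) (hY : Y = Q * X * Q) (hP : P ^ 2 = 1)
    (hXP : X * P * X * P = 1) (hQ : Q ^ 2 = 1) (hPQ : (P * Q) ^ 4 = 1) :
    ∃ s : P4mm → E, (∀ g, f (s g) = g) ∧ ∀ g h, s (g * h) = s g * s h := by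
  set S := Subgroup.closure {X, Y, P, Q}
  have hXS : X ∈ S := Subgroup.subset_closure (by simp)
  have hYS : Y ∈ S := Subgroup.subset_closure (by simp)
  have hPS : P ∈ S := Subgroup.subset_closure (by simp)
  have hQS : Q ∈ S := Subgroup.subset_closure (by simp)
  have hinj : ∀ z ∈ S, f z = 1 → z = 1 := by
    intro z hz hfz
    obtain ⟨a, b, i, j, k, rfl⟩ := exists_normalForm hXY hYP hY hP hXP hQ hPQ hz
    rw [map_normalForm, fX, fY, fP, fQ] at hfz
    obtain ⟨rfl, rfl, hi, hj, hk⟩ := normalForm_eq_one hfz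
    have hR : (Q * P * Q) ^ 2 = 1 := by
      rw [sq] at hP hQ ⊢
      calc Q * P * Q * (Q * P * Q) = Q * (P * (Q * Q) * P) * Q := by simp only [mul_assoc]
        _ = 1 := by rw [hQ, mul_one, hP, mul_one, hQ]
    simp [normalForm, zpow_eq_ite_even hP, zpow_eq_ite_even hQ, zpow_eq_ite_even hR, hi, hj, hk]
  have hex : ∀ g, ∃ z ∈ S, f z = g := by
    intro g
    obtain ⟨a, b, i, j, k, rfl⟩ := eq_normalForm g
    refine ⟨normalForm X Y P Q a b i j k, ?_, by rw [map_normalForm, fX, fY, fP, fQ]⟩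
    exact S.mul_mem (S.mul_mem (S.mul_mem (S.mul_mem (S.zpow_mem hXS _) (S.zpow_mem hYS _))
      (S.zpow_mem hPS _)) (S.zpow_mem (S.mul_mem (S.mul_mem hQS hPS) hQS) _)) (S.zpow_mem hQS _)
  choose s hsS hs using hex
  refine ⟨s, hs, fun g h => ?_⟩
  rw [← mul_inv_eq_one]
  refine hinj _ (S.mul_mem (hsS _) (S.inv_mem (S.mul_mem (hsS _) (hsS _)))) ?_
  rw [map_mul, map_inv, map_mul, hs, hs, hs, mul_inv_cancel]

/-- If the relations of `p4mm` hold exactly for some lifts, the extension splits. -/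
theorem mem_coboundaries_of_hasRelations_one {t : P4mm →* ℤˣ} {M : Type*} [CommGroup M]
    {ω : factorSets t M} (h : HasRelations ω 1) : ω.1 ∈ coboundaries t M := by
  obtain ⟨X, Y, P, Q, fX, fY, fP, fQ, hXY, hYP, hY, hP, hXP, hQ, hPQ⟩ := h
  simp only [Pi.one_apply, map_one] at hXY hYP hP hXP hQ hPQ
  obtain ⟨s, hs, hmul⟩ := exists_section _ fX fY fP fQ hXY hYP hY hP hXP hQ hPQ
  have hs' (g : P4mm) : (s g).base = g := hs g
  refine mem_coboundaries.2 ⟨fun g => (s g).phase⁻¹, fun g h => ?_⟩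
  have h1 := congrArg Extension.phase (hmul g h)
  change _ = (s g).phase * (s h).phase ^ ((t (s g).base : ℤˣ) : ℤ) *
    ω.1 ((s g).base, (s h).base) at h1
  rw [hs', hs'] at h1
  beta_reduce
  rw [h1, inv_inv, inv_zpow, ← mul_assoc, mul_comm (s g).phase⁻¹, mul_assoc _ (s g).phase⁻¹,
    inv_mul_cancel_left, inv_mul_cancel, one_mul]

/-! ### The relations in terms of the factor set -/

section Relations

variable {t : P4mm →* ℤˣ} {M : Type*} [CommGroup M]

theorem factorSet_one_left (ω : factorSets t M) (g : P4mm) : ω.1 (1, g) = ω.1 (1, 1) := by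
  simpa using (mem_factorSets.1 ω.2 1 1 g).symm

theorem factorSet_one_right (ω : factorSets t M) (g : P4mm) :
    ω.1 (g, 1) = ω.1 (1, 1) ^ ((t g : ℤˣ) : ℤ) := by
  simpa using mem_factorSets.1 ω.2 g 1 1

theorem extension_mk_mul (ω : factorSets t M) (a b : M) (g h : P4mm) :
    (⟨a, g⟩ : Extension ω) * ⟨b, h⟩ = ⟨a * b ^ ((t g : ℤˣ) : ℤ) * ω.1 (g, h), g * h⟩ := rfl

theorem inl_apply (ω : factorSets t M) (a : M) :
    Extension.inl ω a = ⟨a * (ω.1 (1, 1))⁻¹, 1⟩ := rfl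

theorem inl_mul_mk (ω : factorSets t M) (a b : M) (g : P4mm) :
    Extension.inl ω a * ⟨b, g⟩ = ⟨a * b, g⟩ := by
  rw [inl_apply, extension_mk_mul, factorSet_one_left ω g, map_one, Units.val_one, zpow_one,
    one_mul, mul_right_comm a, mul_right_comm (a * b), mul_inv_cancel_right]

theorem mk_mul_inl (ω : factorSets t M) (a b : M) (g : P4mm) :
    (⟨b, g⟩ : Extension ω) * Extension.inl ω a = ⟨b * a ^ ((t g : ℤˣ) : ℤ), g⟩ := by
  rw [inl_apply, extension_mk_mul, factorSet_one_right ω g, mul_zpow, inv_zpow, mul_one,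
    ← mul_assoc, inv_mul_cancel_right]

theorem Px_mul_Ty_mul_Px : Px * Ty * Px = Ty := ext_entries rfl rfl rfl rfl rfl rfl

theorem Pxy_mul_Tx_mul_Pxy : Pxy * Tx * Pxy = Ty := ext_entries rfl rfl rfl rfl rfl rfl

theorem Tx_mul_Px_sq : Tx * Px * (Tx * Px) = 1 := ext_entries rfl rfl rfl rfl rfl rfl

theorem Tx_mul_Ty : Tx * Ty = Ty * Tx := ext_entries rfl rfl rfl rfl rfl rfl

theorem Px_mul_Pxy_pow_four : (Px * Pxy) ^ 2 * (Px * Pxy) ^ 2 = 1 :=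
  ext_entries rfl rfl rfl rfl rfl rfl

/-- The action through `t` is the one through the determinant: translations act trivially and
both reflections act by inversion. For `M = ℤ₂` the trivial `t` has this property too, since
inversion is then the identity. -/
structure ActsByDet (t : P4mm →* ℤˣ) (M : Type*) [CommGroup M] : Prop where
  tx : t Tx = 1
  ty : t Ty = 1
  px (a : M) : a ^ ((t Px : ℤˣ) : ℤ) = a⁻¹
  pxy (a : M) : a ^ ((t Pxy : ℤˣ) : ℤ) = a⁻¹

variable (ht : ActsByDet t M) (ω : factorSets t M)
include ht

theorem txty_iff (a b s : M) : (⟨a, Tx⟩ * ⟨b, Ty⟩ * ⟨a, Tx⟩⁻¹ * ⟨b, Ty⟩⁻¹ : Extension ω) =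
    Extension.inl ω s ↔ s = ω.1 (Tx, Ty) / ω.1 (Ty, Tx) := by
  rw [mul_inv_eq_iff_eq_mul, mul_inv_eq_iff_eq_mul, inl_mul_mk, extension_mk_mul,
    extension_mk_mul, ht.tx, ht.ty, Tx_mul_Ty, Extension.ext_iff, and_iff_left rfl,
    eq_div_iff_mul_eq']
  simp only [Units.val_one, zpow_one]
  rw [mul_assoc s, mul_comm b a, mul_comm s, mul_assoc (a * b) s, mul_right_inj, eq_comm]

theorem txpx_iff (a c s : M) : (⟨a, Tx⟩ * ⟨c, Px⟩ * ⟨a, Tx⟩ * ⟨c, Px⟩ : Extension ω) =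
    Extension.inl ω s ↔ s = ω.1 (Tx * Px, Tx * Px) * ω.1 (1, 1) := by
  rw [mul_assoc _ _ (⟨c, Px⟩ : Extension ω), extension_mk_mul, extension_mk_mul, inl_apply,
    Tx_mul_Px_sq, Extension.ext_iff, and_iff_left rfl, ← mul_inv_eq_iff_eq_mul,
    eq_comm, map_mul, ht.tx, one_mul, ht.px]
  simp

theorem px_iff (c s : M) : (⟨c, Px⟩ ^ 2 : Extension ω) = Extension.inl ω s ↔
    s = ω.1 (Px, Px) * ω.1 (1, 1) := by
  rw [sq, extension_mk_mul, inl_apply, ← sq Px, Px_sq, Extension.ext_iff, and_iff_left rfl,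
    ← mul_inv_eq_iff_eq_mul, eq_comm, ht.px]
  simp

theorem pxy_iff (d s : M) : (⟨d, Pxy⟩ ^ 2 : Extension ω) = Extension.inl ω s ↔
    s = ω.1 (Pxy, Pxy) * ω.1 (1, 1) := by
  rw [sq, extension_mk_mul, inl_apply, ← sq Pxy, Pxy_sq, Extension.ext_iff, and_iff_left rfl,
    ← mul_inv_eq_iff_eq_mul, eq_comm, ht.pxy]
  simp

/-- Multiplying the relation by the lift of `P_x` on the left removes the inverse of the lift of
`T_y`: it becomes `P Y P = s⁻¹ Y`. -/
theorem typx_iff (b c s : M) : (⟨b, Ty⟩ * ⟨c, Px⟩ * ⟨b, Ty⟩⁻¹ * ⟨c, Px⟩ : Extension ω) =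
    Extension.inl ω s ↔ b ^ 2 = s * (ω.1 (Px, Ty) * ω.1 (Px * Ty, Px)) := by
  rw [← eq_mul_inv_iff_mul_eq, mul_inv_eq_iff_eq_mul, ← mul_right_inj (⟨c, Px⟩ : Extension ω),
    ← mul_assoc, ← mul_assoc, ← mul_assoc, mk_mul_inl, ht.px, mul_comm c, ← inl_mul_mk,
    mul_inv_cancel_right, inl_mul_mk, extension_mk_mul, extension_mk_mul, Px_mul_Ty_mul_Px,
    Extension.ext_iff, and_iff_left rfl, map_mul, ht.ty, mul_one, ht.px, ht.px]
  dsimp only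
  rw [mul_right_comm _ c⁻¹, mul_assoc c, mul_assoc c, mul_comm c, mul_inv_cancel_right,
    eq_inv_mul_iff_mul_eq, sq, mul_assoc b⁻¹, mul_left_comm s, inv_mul_eq_iff_eq_mul, eq_comm]

theorem y_eq_iff (a b d : M) : (⟨b, Ty⟩ : Extension ω) = ⟨d, Pxy⟩ * ⟨a, Tx⟩ * ⟨d, Pxy⟩ ↔
    b = a⁻¹ * (ω.1 (Pxy, Tx) * ω.1 (Pxy * Tx, Pxy)) := by
  rw [extension_mk_mul, extension_mk_mul, Pxy_mul_Tx_mul_Pxy, Extension.ext_iff, and_iff_left rfl,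
    map_mul, ht.tx, mul_one, ht.pxy, ht.pxy]
  dsimp only
  rw [mul_right_comm _ d⁻¹, mul_assoc d, mul_assoc d, mul_comm d, mul_inv_cancel_right, mul_assoc]

theorem pxpxy_iff (c d s : M) : ((⟨c, Px⟩ * ⟨d, Pxy⟩) ^ 4 : Extension ω) = Extension.inl ω s ↔
    s = (c * d⁻¹ * ω.1 (Px, Pxy)) ^ 4 * (ω.1 (Px * Pxy, Px * Pxy) ^ 2 *
      ω.1 ((Px * Pxy) ^ 2, (Px * Pxy) ^ 2) * ω.1 (1, 1)) := by
  have hr (a : M) : a ^ ((t (Px * Pxy) : ℤˣ) : ℤ) = a := by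
    rw [map_mul, Units.val_mul, mul_comm, zpow_mul, ht.pxy, ht.px, inv_inv]
  have hr2 (a : M) : a ^ ((t ((Px * Pxy) ^ 2) : ℤˣ) : ℤ) = a := by
    rw [sq, map_mul, Units.val_mul, zpow_mul, hr, hr]
  rw [show 4 = 2 * 2 from rfl, pow_mul, sq (_ * _), sq (_ * _), extension_mk_mul,
    extension_mk_mul, extension_mk_mul, ← sq (Px * Pxy), Px_mul_Pxy_pow_four, inl_apply,
    Extension.ext_iff, and_iff_left rfl, ← mul_inv_eq_iff_eq_mul, inv_inv, eq_comm, hr, hr2, ht.px]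
  simp only [pow_mul, sq, mul_assoc, mul_comm, mul_left_comm]

/-- The lifts only enter the relations through the phase `b` of the lift of `T_y` and the phase
`m` of the product of the lifts of `P_x` and `P_xy`, and these two phases are arbitrary. -/
theorem hasRelations_iff (s : Rel → M) : HasRelations ω s ↔
    s .txty = ω.1 (Tx, Ty) / ω.1 (Ty, Tx) ∧
    s .px = ω.1 (Px, Px) * ω.1 (1, 1) ∧
    s .txpx = ω.1 (Tx * Px, Tx * Px) * ω.1 (1, 1) ∧
    s .pxy = ω.1 (Pxy, Pxy) * ω.1 (1, 1) ∧
    (∃ b : M, b ^ 2 = s .typx * (ω.1 (Px, Ty) * ω.1 (Px * Ty, Px))) ∧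
    (∃ m : M, s .pxpxy = m ^ 4 * (ω.1 (Px * Pxy, Px * Pxy) ^ 2 *
      ω.1 ((Px * Pxy) ^ 2, (Px * Pxy) ^ 2) * ω.1 (1, 1))) := by
  constructor
  · rintro ⟨⟨a, gx⟩, ⟨b, gy⟩, ⟨c, gp⟩, ⟨d, gq⟩, hx, hy, hp, hq, h1, h2, h3, h4, h5, h6, h7⟩
    obtain rfl : gx = Tx := hx
    obtain rfl : gy = Ty := hy
    obtain rfl : gp = Px := hp
    obtain rfl : gq = Pxy := hq
    exact ⟨(txty_iff ht ω a b _).1 h1, (px_iff ht ω c _).1 h4, (txpx_iff ht ω a c _).1 h5,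
      (pxy_iff ht ω d _).1 h6, ⟨b, (typx_iff ht ω b c _).1 h2⟩, ⟨_, (pxpxy_iff ht ω c d _).1 h7⟩⟩
  · rintro ⟨h1, h4, h5, h6, ⟨b, h2⟩, ⟨m, h7⟩⟩
    refine ⟨⟨b⁻¹ * (ω.1 (Pxy, Tx) * ω.1 (Pxy * Tx, Pxy)), Tx⟩, ⟨b, Ty⟩,
      ⟨m * (ω.1 (Px, Pxy))⁻¹, Px⟩, ⟨1, Pxy⟩, rfl, rfl, rfl, rfl, (txty_iff ht ω _ b _).2 h1,
      (typx_iff ht ω b _ _).2 h2, (y_eq_iff ht ω _ b 1).2 ?_, (px_iff ht ω _ _).2 h4,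
      (txpx_iff ht ω _ _ _).2 h5, (pxy_iff ht ω 1 _).2 h6, (pxpxy_iff ht ω _ 1 _).2 ?_⟩
    · rw [mul_inv, inv_inv, inv_mul_cancel_right]
    · simpa using h7

end Relations

/-! ### Factor sets with integral exponents -/

theorem mul_lin_apply (g h : P4mm) (i j : Fin 2) :
    (g * h).lin.1 i j = g.lin.1 i 0 * h.lin.1 0 j + g.lin.1 i 1 * h.lin.1 1 j := by
  rw [mul_lin, Matrix.mul_apply, Fin.sum_univ_two]

theorem mul_trans_apply (g h : P4mm) (i : Fin 2) :
    (g * h).trans i = g.lin.1 i 0 * h.trans 0 + g.lin.1 i 1 * h.trans 1 + g.trans i := by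
  rw [mul_trans, Pi.add_apply, Matrix.mulVec_eq_sum]
  simp [Fin.sum_univ_two, mul_comm]

theorem coe_twist (g : P4mm) : ((twist g : ℤˣ) : ℤ) =
    g.lin.1 0 0 * g.lin.1 1 1 - g.lin.1 0 1 * g.lin.1 1 0 :=
  Matrix.det_fin_two g.lin.1

/-- An additively written `twist`-twisted factor set with values in `ℤ`. -/
def IsIntFactorSet (f : P4mm → P4mm → ℤ) : Prop :=
  ∀ g h k, f g h + f (g * h) k = f g (h * k) + ((twist g : ℤˣ) : ℤ) * f h k

/-- An integral function whose reduction modulo `2` is a factor set with values in `ℤ/2`. -/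
def IsModTwoFactorSet (f : P4mm → P4mm → ℤ) : Prop :=
  ∀ g h k, (f g h + f (g * h) k : ZMod 2) = f g (h * k) + f h k

theorem intCast_units_zmod_two (u : ℤˣ) : (((u : ℤˣ) : ℤ) : ZMod 2) = 1 := by
  rcases Int.units_eq_one_or u with rfl | rfl <;> decide

theorem IsIntFactorSet.isModTwoFactorSet {f : P4mm → P4mm → ℤ} (hf : IsIntFactorSet f) :
    IsModTwoFactorSet f := by
  intro g h k
  have := congrArg (Int.cast : ℤ → ZMod 2) (hf g h k)
  push_cast at this
  rwa [intCast_units_zmod_two, one_mul] at this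

/-- The twisted factor sets `u ^ f(g, h)`. -/
def powFactorSet (M : Type*) [CommGroup M] {f : P4mm → P4mm → ℤ} (hf : IsIntFactorSet f) :
    M →* factorSets twist M where
  toFun u := ⟨fun p => u ^ f p.1 p.2, mem_factorSets.2 fun g h k => by
    rw [← zpow_add, hf, zpow_add, mul_comm ((twist g : ℤˣ) : ℤ), zpow_mul]⟩
  map_one' := Subtype.ext (funext fun _ => one_zpow _)
  map_mul' u v := Subtype.ext (funext fun _ => mul_zpow u v _)

theorem Z2.zpow_eq_zpow (u : Z2) {m n : ℤ} (h : (m : ZMod 2) = n) : u ^ m = u ^ n := by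
  obtain ⟨c, hc⟩ := (ZMod.intCast_eq_intCast_iff_dvd_sub m n 2).1 h
  have hu : u ^ (2 : ℤ) = 1 := by
    have : u ^ 2 = 1 := Subtype.ext u.2
    exact_mod_cast this
  obtain rfl : n = m + 2 * c := by push_cast at hc; linarith
  rw [zpow_add, zpow_mul, hu, one_zpow, mul_one]

/-- The untwisted factor sets `u ^ f(g, h)` for a sign `u`. -/
def signFactorSet {f : P4mm → P4mm → ℤ} (hf : IsModTwoFactorSet f) :
    Z2 →* factorSets (1 : P4mm →* ℤˣ) Z2 where
  toFun u := ⟨fun p => u ^ f p.1 p.2, mem_factorSets.2 fun g h k => by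
    rw [MonoidHom.one_apply, Units.val_one, zpow_one, ← zpow_add, ← zpow_add]
    exact Z2.zpow_eq_zpow u (by push_cast; exact hf g h k)⟩
  map_one' := Subtype.ext (funext fun _ => one_zpow _)
  map_mul' u v := Subtype.ext (funext fun _ => mul_zpow u v _)

/-- A twisted coboundary, or more generally a factor set, that is divisible by an integer remains
a factor set after the division, although it need not remain a coboundary. -/
theorem isIntFactorSet_of_mul {f c : P4mm → P4mm → ℤ} (hc : IsIntFactorSet c) (l : P4mm → ℤ)
    {m : ℤ} (hm : m ≠ 0) (h : ∀ g h, m * f g h =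
      c g h + (l g + ((twist g : ℤˣ) : ℤ) * l h - l (g * h))) : IsIntFactorSet f := by
  intro g₁ g₂ g₃
  have h' := hc g₁ g₂ g₃
  refine mul_left_cancel₀ hm ?_
  rw [mul_add, mul_add, mul_left_comm, h, h, h, h, mul_assoc, map_mul, Units.val_mul]
  linear_combination h'

/-- The area `b_g × A_g b_h` spanned by the translation parts. -/
theorem isIntFactorSet_cross : IsIntFactorSet fun g h =>
    g.trans 0 * (g.lin.1 1 0 * h.trans 0 + g.lin.1 1 1 * h.trans 1) -
      g.trans 1 * (g.lin.1 0 0 * h.trans 0 + g.lin.1 0 1 * h.trans 1) := by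
  intro g h k
  simp only [mul_lin_apply, mul_trans_apply, coe_twist]
  ring

/-- The exponent of the flux through a unit cell: half of the area `b_g × A_g b_h`, made integral
by a coboundary. -/
def fluxExp (g h : P4mm) : ℤ :=
  g.trans 0 * (g.lin.1 1 0 * h.trans 0 + g.lin.1 1 1 * h.trans 1) +
    g.lin.1 0 1 * g.lin.1 1 0 * (h.trans 0 * h.trans 1)

theorem isIntFactorSet_fluxExp : IsIntFactorSet fluxExp := by
  refine isIntFactorSet_of_mul (c := _) isIntFactorSet_cross
    (fun g => -(g.trans 0 * g.trans 1)) two_ne_zero fun g h => ?_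
  have h1 : g.lin.1 0 0 * g.lin.1 1 0 = 0 := by
    rcases lin_cases g with ⟨-, h, -⟩ | ⟨h, -⟩ <;> simp [h]
  have h2 : g.lin.1 0 1 * g.lin.1 1 1 = 0 := by
    rcases lin_cases g with ⟨h, -⟩ | ⟨-, h, -⟩ <;> simp [h]
  simp only [fluxExp, mul_trans_apply, coe_twist]
  linear_combination -h.trans 0 ^ 2 * h1 - h.trans 1 ^ 2 * h2

theorem isIntFactorSet_zero : IsIntFactorSet fun _ _ => 0 := fun g h k => by simp

/-- The coboundary of the half-integral cochain `(b₀ + b₁) / 2`. -/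
def halfTransExp (g h : P4mm) : ℤ :=
  ((g.trans 0 + g.trans 1) + (g.lin.1 0 0 * g.lin.1 1 1 - g.lin.1 0 1 * g.lin.1 1 0) *
    (h.trans 0 + h.trans 1) - ((g * h).trans 0 + (g * h).trans 1)) / 2

theorem isIntFactorSet_halfTransExp : IsIntFactorSet halfTransExp := by
  refine isIntFactorSet_of_mul isIntFactorSet_zero
    (fun g => g.trans 0 + g.trans 1) two_ne_zero fun g h => ?_
  rw [zero_add, coe_twist]
  refine Int.mul_ediv_cancel' ?_
  rw [mul_trans_apply, mul_trans_apply]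
  rcases lin_cases g with ⟨h01, h10, h00 | h00, h11 | h11⟩ | ⟨h00, h11, h01 | h01, h10 | h10⟩ <;>
    rw [h00, h01, h10, h11] <;> omega

/-- The angle of `A e₀` in units of a quarter turn, modulo `4`. It is a crossed homomorphism to
`ℤ/4`. -/
def quarterTurns (g : P4mm) : ℤ :=
  g.lin.1 0 0 * g.lin.1 0 0 - g.lin.1 0 0 + g.lin.1 1 0

/-- The coboundary of a quarter of the angle `quarterTurns`. -/
def quarterTurnExp (g h : P4mm) : ℤ :=
  (quarterTurns g + (g.lin.1 0 0 * g.lin.1 1 1 - g.lin.1 0 1 * g.lin.1 1 0) * quarterTurns h -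
    quarterTurns (g * h)) / 4

theorem isIntFactorSet_quarterTurnExp : IsIntFactorSet quarterTurnExp := by
  refine isIntFactorSet_of_mul isIntFactorSet_zero quarterTurns four_ne_zero fun g h => ?_
  rw [zero_add, coe_twist]
  refine Int.mul_ediv_cancel' ?_
  have hh : (h.lin.1 0 0 = 0 ∧ (h.lin.1 1 0 = 1 ∨ h.lin.1 1 0 = -1)) ∨
      (h.lin.1 1 0 = 0 ∧ (h.lin.1 0 0 = 1 ∨ h.lin.1 0 0 = -1)) := by
    have := lin_cases h
    tauto
  simp only [quarterTurns, mul_lin_apply]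
  rcases lin_cases g with ⟨h01, h10, h00 | h00, h11 | h11⟩ | ⟨h00, h11, h01 | h01, h10 | h10⟩ <;>
    rw [h00, h01, h10, h11] <;>
    rcases hh with ⟨k0, k1 | k1⟩ | ⟨k0, k1 | k1⟩ <;> rw [k0, k1] <;> decide

/-- A homomorphism from `p4mm` to `ℤ/2`, given by integral representatives of its values. -/
def IsModTwoChar (χ : P4mm → ℤ) : Prop := ∀ g h, (χ (g * h) : ZMod 2) = χ g + χ h

/-- Cup products of characters are factor sets. -/
theorem IsModTwoChar.mul {χ ψ : P4mm → ℤ} (hχ : IsModTwoChar χ) (hψ : IsModTwoChar ψ) :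
    IsModTwoFactorSet fun g h => χ g * ψ h := by
  intro g h k
  push_cast
  rw [hχ, hψ]
  ring

theorem IsModTwoChar.add {χ ψ : P4mm → ℤ} (hχ : IsModTwoChar χ) (hψ : IsModTwoChar ψ) :
    IsModTwoChar fun g => χ g + ψ g := by
  intro g h
  push_cast
  rw [hχ, hψ]
  ring

/-- The character with value `1` on translations by unit vectors and `0` on `P_x`, `P_xy`. -/
def transChar (g : P4mm) : ℤ := g.trans 0 + g.trans 1

/-- The character with value `1` on `P_xy` and `0` on `P_x` and the translations. -/
def swapChar (g : P4mm) : ℤ := g.lin.1 0 1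

/-- The character with value `1` on `P_x` and `0` on `P_xy` and the translations. -/
def signChar (g : P4mm) : ℤ :=
  (1 - (g.lin.1 0 0 * g.lin.1 1 1 - g.lin.1 0 1 * g.lin.1 1 0)) / 2 + g.lin.1 0 1

theorem isModTwoChar_transChar : IsModTwoChar transChar := by
  intro g h
  rw [← Int.cast_add, ZMod.intCast_eq_intCast_iff_dvd_sub]
  simp only [transChar, mul_trans_apply]
  rcases lin_cases g with ⟨h01, h10, h00 | h00, h11 | h11⟩ | ⟨h00, h11, h01 | h01, h10 | h10⟩ <;>
    rw [h00, h01, h10, h11] <;> omega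

theorem isModTwoChar_swapChar : IsModTwoChar swapChar := by
  intro g h
  have := lin_cases h
  rw [← Int.cast_add, ZMod.intCast_eq_intCast_iff_dvd_sub]
  simp only [swapChar, mul_lin_apply]
  rcases lin_cases g with ⟨h01, h10, h00 | h00, h11 | h11⟩ | ⟨h00, h11, h01 | h01, h10 | h10⟩ <;>
    rw [h00, h01] <;> omega

theorem isModTwoChar_signChar : IsModTwoChar signChar := by
  refine IsModTwoChar.add (χ := fun g => (1 - (g.lin.1 0 0 * g.lin.1 1 1 -
    g.lin.1 0 1 * g.lin.1 1 0)) / 2) ?_ isModTwoChar_swapChar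
  intro g h
  simp only [← coe_twist, map_mul, Units.val_mul]
  rcases Int.units_eq_one_or (twist g) with hg | hg <;>
    rcases Int.units_eq_one_or (twist h) with hh | hh <;> rw [hg, hh] <;> decide

/-! ### The invariants of a factor set -/

theorem actsByDet_twist (M : Type*) [CommGroup M] : ActsByDet twist M where
  tx := Units.ext rfl
  ty := Units.ext rfl
  px a := by
    rw [coe_twist]
    exact zpow_neg_one a
  pxy a := by
    rw [coe_twist]
    exact zpow_neg_one a

theorem Z2.sq_eq_one (u : Z2) : u ^ 2 = 1 := Subtype.ext u.2

theorem Z2.inv_eq (u : Z2) : u⁻¹ = u := by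
  rw [inv_eq_iff_mul_eq_one, ← sq, Z2.sq_eq_one]

theorem actsByDet_one : ActsByDet (1 : P4mm →* ℤˣ) Z2 where
  tx := rfl
  ty := rfl
  px a := by simp [Z2.inv_eq]
  pxy a := by simp [Z2.inv_eq]

section Coboundary

variable {t : P4mm →* ℤˣ} {M : Type*} [CommGroup M] {ω : P4mm × P4mm → M}

theorem coboundary_commute (hω : ω ∈ coboundaries t M) {g h : P4mm} (hgh : g * h = h * g)
    (hg : t g = 1) (hh : t h = 1) : ω (g, h) / ω (h, g) = 1 := by
  obtain ⟨l, hl⟩ := mem_coboundaries.1 hω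
  rw [hl, hl, hgh, hg, hh, Units.val_one, zpow_one, zpow_one, mul_comm (l g), div_self']

theorem coboundary_involution (hω : ω ∈ coboundaries t M) {g : P4mm} (hgg : g * g = 1)
    (hg : ∀ a : M, a ^ ((t g : ℤˣ) : ℤ) = a⁻¹) : ω (g, g) * ω (1, 1) = 1 := by
  obtain ⟨l, hl⟩ := mem_coboundaries.1 hω
  rw [hl, hl, hgg, hg, map_one, Units.val_one, zpow_one, mul_one]
  simp

/-- The square of a lift of an involution commutes with the lift, which inverts the coefficients, so
it is a sign. -/
theorem factorSet_involution_sq (ω : factorSets t M) {g : P4mm} (hgg : g * g = 1)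
    (hg : ∀ a : M, a ^ ((t g : ℤˣ) : ℤ) = a⁻¹) : (ω.1 (g, g) * ω.1 (1, 1)) ^ 2 = 1 := by
  have h := mem_factorSets.1 ω.2 g g g
  rw [hgg, factorSet_one_left, factorSet_one_right ω g, hg, hg] at h
  rw [sq]
  nth_rw 1 [h]
  rw [← mul_inv_rev, inv_mul_cancel]

end Coboundary

/-- The values `(σ_txty, …, σ_pxpxy)` of a `ℤ₂`-valued factor set. -/
def signInvariants : factorSets (1 : P4mm →* ℤˣ) Z2 →* (Rel → Z2) where
  toFun ω
    | .txty => ω.1 (Tx, Ty) / ω.1 (Ty, Tx)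
    | .typx => ω.1 (Px, Ty) * ω.1 (Px * Ty, Px)
    | .px => ω.1 (Px, Px) * ω.1 (1, 1)
    | .txpx => ω.1 (Tx * Px, Tx * Px) * ω.1 (1, 1)
    | .pxy => ω.1 (Pxy, Pxy) * ω.1 (1, 1)
    | .pxpxy => ω.1 ((Px * Pxy) ^ 2, (Px * Pxy) ^ 2) * ω.1 (1, 1)
  map_one' := by
    funext r
    cases r <;> first | exact mul_one 1 | exact div_one 1
  map_mul' ω ω' := by
    funext r
    cases r <;> first | exact mul_mul_mul_comm .. | exact mul_div_mul_comm ..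

theorem hasRelations_iff_signInvariants (ω : factorSets (1 : P4mm →* ℤˣ) Z2) (s : Rel → Z2) :
    HasRelations ω s ↔ signInvariants ω = s := by
  have h4 (u : Z2) : u ^ 4 = 1 := by rw [pow_mul u 2 2, Z2.sq_eq_one]
  rw [hasRelations_iff actsByDet_one]
  simp only [Z2.sq_eq_one, h4, one_mul, exists_const]
  constructor
  · rintro ⟨h1, h2, h3, h4, h5, h6⟩
    funext r
    cases r
    · exact h1.symm
    · rw [eq_comm, mul_eq_one_iff_inv_eq, Z2.inv_eq] at h5
      exact h5.symm
    · exact h2.symm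
    · exact h3.symm
    · exact h4.symm
    · exact h6.symm
  · rintro rfl
    refine ⟨rfl, rfl, rfl, rfl, ?_, rfl⟩
    rw [eq_comm, mul_eq_one_iff_inv_eq, Z2.inv_eq]
    rfl

/-- Two `ℤ₂`-valued factor sets are cohomologous if and only if their invariants agree. -/
theorem ker_signInvariants : signInvariants.ker =
    (coboundaries (1 : P4mm →* ℤˣ) Z2).subgroupOf (factorSets (1 : P4mm →* ℤˣ) Z2) := by
  ext ω
  rw [MonoidHom.mem_ker, Subgroup.mem_subgroupOf]
  constructor
  · intro h
    exact mem_coboundaries_of_hasRelations_one ((hasRelations_iff_signInvariants ω 1).2 h)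
  · intro h
    funext r
    cases r
    · exact coboundary_commute h Tx_mul_Ty rfl rfl
    · obtain ⟨l, hl⟩ := mem_coboundaries.1 h
      change ω.1 (Px, Ty) * ω.1 (Px * Ty, Px) = 1
      rw [hl, hl, Px_mul_Ty_mul_Px]
      simp only [MonoidHom.one_apply, Units.val_one, zpow_one, Z2.inv_eq]
      calc l Px * l Ty * l (Px * Ty) * (l (Px * Ty) * l Px * l Ty)
          = (l Px * l Ty * l (Px * Ty)) ^ 2 := by rw [sq]; ac_rfl
        _ = 1 := Z2.sq_eq_one _
    · exact coboundary_involution h (by rw [← sq, Px_sq]) actsByDet_one.px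
    · exact coboundary_involution h Tx_mul_Px_sq actsByDet_one.px
    · exact coboundary_involution h (by rw [← sq, Pxy_sq]) actsByDet_one.pxy
    · exact coboundary_involution h Px_mul_Pxy_pow_four actsByDet_one.px

/-- The exponents of factor sets for which one relation has a nontrivial value. -/
def relExp : Rel → P4mm → P4mm → ℤ
  | .txty => fluxExp
  | .typx => halfTransExp
  | .px => fun g h => (transChar g + signChar g) * signChar h
  | .txpx => fun g h => transChar g * transChar h
  | .pxy => fun g h => swapChar g * swapChar h
  | .pxpxy => quarterTurnExp

theorem isModTwoFactorSet_relExp (r : Rel) : IsModTwoFactorSet (relExp r) := by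
  cases r
  · exact isIntFactorSet_fluxExp.isModTwoFactorSet
  · exact isIntFactorSet_halfTransExp.isModTwoFactorSet
  · exact (isModTwoChar_transChar.add isModTwoChar_signChar).mul isModTwoChar_signChar
  · exact isModTwoChar_transChar.mul isModTwoChar_transChar
  · exact isModTwoChar_swapChar.mul isModTwoChar_swapChar
  · exact isIntFactorSet_quarterTurnExp.isModTwoFactorSet

/-- The exponents of `signInvariants` on the factor set `u ^ f(g, h)`. -/
def relValue (f : P4mm → P4mm → ℤ) : Rel → ℤ
  | .txty => f Tx Ty - f Ty Tx
  | .typx => f Px Ty + f (Px * Ty) Px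
  | .px => f Px Px + f 1 1
  | .txpx => f (Tx * Px) (Tx * Px) + f 1 1
  | .pxy => f Pxy Pxy + f 1 1
  | .pxpxy => f ((Px * Pxy) ^ 2) ((Px * Pxy) ^ 2) + f 1 1

theorem signInvariants_signFactorSet {f : P4mm → P4mm → ℤ} (hf : IsModTwoFactorSet f) (u : Z2)
    (r : Rel) : signInvariants (signFactorSet hf u) r = u ^ relValue f r := by
  cases r <;> simp only [relValue, zpow_add, zpow_sub] <;> rfl

open Classical in
theorem relValue_relExp (r r' : Rel) :
    (relValue (relExp r) r' : ZMod 2) = (if r' = r then 1 else 0 : ℤ) := by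
  cases r <;> cases r' <;> simp only [reduceCtorEq, if_true, if_false] <;> rfl

open Classical in
theorem signInvariants_relExp (r : Rel) (u : Z2) :
    signInvariants (signFactorSet (isModTwoFactorSet_relExp r) u) = Pi.mulSingle r u := by
  funext r'
  rw [signInvariants_signFactorSet, Z2.zpow_eq_zpow u (relValue_relExp r r'), Pi.mulSingle_apply]
  split_ifs <;> simp

/-! ### Classes with coefficients in `ℤ₂` -/

open Classical in
theorem signInvariants_surjective : Function.Surjective signInvariants := by
  intro s
  let φ (r : Rel) := signFactorSet (isModTwoFactorSet_relExp r) (s r)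
  refine ⟨φ .txty * φ .typx * φ .px * φ .txpx * φ .pxy * φ .pxpxy, ?_⟩
  simp only [map_mul, φ, signInvariants_relExp]
  funext r
  cases r <;> simp

/-- The isomorphism `H²(p4mm, ℤ₂) ≃ ℤ₂⁶`. -/
def signEquiv : H2 (1 : P4mm →* ℤˣ) Z2 ≃* (Rel → Z2) :=
  (QuotientGroup.quotientMulEquivOfEq ker_signInvariants.symm).trans
    (QuotientGroup.quotientKerEquivOfSurjective _ signInvariants_surjective)

theorem signEquiv_cls (ω : factorSets (1 : P4mm →* ℤˣ) Z2) :
    signEquiv (cls ω) = signInvariants ω := rfl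

/-! ### Classes with coefficients in `U(1)` -/

theorem involution_mem_Z2 {t : P4mm →* ℤˣ} (ω : factorSets t Circle) {g : P4mm}
    (hgg : g * g = 1) (hg : ∀ a : Circle, a ^ ((t g : ℤˣ) : ℤ) = a⁻¹) :
    ω.1 (g, g) * ω.1 (1, 1) ∈ Z2 :=
  factorSet_involution_sq ω hgg hg

theorem twist_Tx_mul_Px (a : Circle) : a ^ ((twist (Tx * Px) : ℤˣ) : ℤ) = a⁻¹ := by
  rw [map_mul, (actsByDet_twist Circle).tx, one_mul, (actsByDet_twist Circle).px]

/-- The values `(α_txty, α_px, α_txpx, α_pxy)` of a twisted `U(1)`-valued factor set. -/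
def circleInvariants : factorSets twist Circle →* Circle × Z2 × Z2 × Z2 where
  toFun ω := (ω.1 (Tx, Ty) / ω.1 (Ty, Tx),
    ⟨_, involution_mem_Z2 ω (by rw [← sq, Px_sq]) (actsByDet_twist Circle).px⟩,
    ⟨_, involution_mem_Z2 ω Tx_mul_Px_sq twist_Tx_mul_Px⟩,
    ⟨_, involution_mem_Z2 ω (by rw [← sq, Pxy_sq]) (actsByDet_twist Circle).pxy⟩)
  map_one' := Prod.ext (div_one 1) (Prod.ext (Subtype.ext (mul_one 1))
    (Prod.ext (Subtype.ext (mul_one 1)) (Subtype.ext (mul_one 1))))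
  map_mul' ω ω' := Prod.ext (mul_div_mul_comm ..) (Prod.ext (Subtype.ext (mul_mul_mul_comm ..))
    (Prod.ext (Subtype.ext (mul_mul_mul_comm ..)) (Subtype.ext (mul_mul_mul_comm ..))))

theorem Circle.exists_pow_eq {n : ℕ} (hn : n ≠ 0) (z : Circle) : ∃ w : Circle, w ^ n = z := by
  obtain ⟨x, rfl⟩ := Circle.exp_surjective z
  refine ⟨Circle.exp (x / n), ?_⟩
  rw [← Circle.exp_nsmul, nsmul_eq_mul, mul_div_cancel₀ _ (Nat.cast_ne_zero.2 hn)]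

/-- Over `U(1)` the values of `typx` and `pxpxy` can be normalized to `1`, since squares and fourth
powers are arbitrary. -/
theorem hasRelations_canonical_iff (ω : factorSets twist Circle) (a : Circle) (p q r : Z2) :
    HasRelations ω (canonical a p q r) ↔ circleInvariants ω = (a, p, q, r) := by
  rw [hasRelations_iff (actsByDet_twist Circle)]
  have h1 : ∃ b : Circle, b ^ 2 = canonical a p q r .typx *
      (ω.1 (Px, Ty) * ω.1 (Px * Ty, Px)) := Circle.exists_pow_eq two_ne_zero _
  have h2 : ∃ m : Circle, canonical a p q r .pxpxy = m ^ 4 * (ω.1 (Px * Pxy, Px * Pxy) ^ 2 *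
      ω.1 ((Px * Pxy) ^ 2, (Px * Pxy) ^ 2) * ω.1 (1, 1)) := by
    obtain ⟨m, hm⟩ := Circle.exists_pow_eq four_ne_zero (ω.1 (Px * Pxy, Px * Pxy) ^ 2 *
      ω.1 ((Px * Pxy) ^ 2, (Px * Pxy) ^ 2) * ω.1 (1, 1))⁻¹
    exact ⟨m, by rw [hm, inv_mul_cancel]; rfl⟩
  rw [iff_true_intro h1, iff_true_intro h2, and_true, and_true, Prod.ext_iff, Prod.ext_iff,
    Prod.ext_iff, Subtype.ext_iff, Subtype.ext_iff, Subtype.ext_iff]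
  exact and_congr eq_comm (and_congr eq_comm (and_congr eq_comm eq_comm))

theorem ker_circleInvariants : circleInvariants.ker =
    (coboundaries twist Circle).subgroupOf (factorSets twist Circle) := by
  ext ω
  rw [MonoidHom.mem_ker, Subgroup.mem_subgroupOf]
  constructor
  · intro h
    have h1 : canonical 1 1 1 1 = 1 := by
      funext r
      cases r <;> rfl
    refine mem_coboundaries_of_hasRelations_one ?_
    rw [← h1]
    exact (hasRelations_canonical_iff ω 1 1 1 1).2 h
  · intro h
    refine Prod.ext (coboundary_commute h Tx_mul_Ty (actsByDet_twist Circle).tx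
      (actsByDet_twist Circle).ty) (Prod.ext (Subtype.ext ?_) (Prod.ext (Subtype.ext ?_)
        (Subtype.ext ?_)))
    · exact coboundary_involution h (by rw [← sq, Px_sq]) (actsByDet_twist Circle).px
    · exact coboundary_involution h Tx_mul_Px_sq twist_Tx_mul_Px
    · exact coboundary_involution h (by rw [← sq, Pxy_sq]) (actsByDet_twist Circle).pxy

theorem circleInvariants_inclZ2 (ω : factorSets (1 : P4mm →* ℤˣ) Z2) :
    circleInvariants (inclZ2 twist ω) = ((signInvariants ω .txty : Circle),
      signInvariants ω .px, signInvariants ω .txpx, signInvariants ω .pxy) := rfl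

/-- Twisted `U(1)`-valued factor sets with prescribed invariants. -/
def circleFactorSet (v : Circle × Z2 × Z2 × Z2) : factorSets twist Circle :=
  powFactorSet Circle isIntFactorSet_fluxExp v.1 *
    inclZ2 twist (signFactorSet (isModTwoFactorSet_relExp .px) v.2.1 *
      signFactorSet (isModTwoFactorSet_relExp .txpx) v.2.2.1 *
      signFactorSet (isModTwoFactorSet_relExp .pxy) v.2.2.2)

open Classical in
theorem circleInvariants_circleFactorSet (v : Circle × Z2 × Z2 × Z2) :
    circleInvariants (circleFactorSet v) = v := by
  have h : circleInvariants (powFactorSet Circle isIntFactorSet_fluxExp v.1) = (v.1, 1, 1, 1) := by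
    have h1 : (v.1 : Circle) ^ fluxExp Tx Ty / v.1 ^ fluxExp Ty Tx = v.1 := by
      rw [show fluxExp Tx Ty = 1 from rfl, show fluxExp Ty Tx = 0 from rfl]
      simp
    refine Prod.ext h1 (Prod.ext (Subtype.ext ?_) (Prod.ext (Subtype.ext ?_) (Subtype.ext ?_))) <;>
      exact mul_one 1
  rw [circleFactorSet, map_mul, h, circleInvariants_inclZ2]
  simp only [map_mul, signInvariants_relExp]
  refine Prod.ext ?_ (Prod.ext ?_ (Prod.ext ?_ ?_)) <;> simp

theorem continuous_circleFactorSet : Continuous circleFactorSet := by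
  refine Continuous.subtype_mk (continuous_pi fun p => ?_) _
  change Continuous fun v : Circle × Z2 × Z2 × Z2 => v.1 ^ fluxExp p.1 p.2 *
    (((v.2.1 ^ relExp .px p.1 p.2 * v.2.2.1 ^ relExp .txpx p.1 p.2 *
      v.2.2.2 ^ relExp .pxy p.1 p.2 : Z2)) : Circle)
  fun_prop

theorem continuous_circleInvariants : Continuous circleInvariants := by
  have h (p : P4mm × P4mm) : Continuous fun ω : factorSets twist Circle => ω.1 p :=
    (continuous_apply p).comp continuous_subtype_val
  exact ((h _).div' (h _)).prodMk ((Continuous.subtype_mk ((h _).mul (h _)) _).prodMk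
    ((Continuous.subtype_mk ((h _).mul (h _)) _).prodMk
      (Continuous.subtype_mk ((h _).mul (h _)) _)))

/-- The isomorphism of topological groups `H²_t(p4mm, U(1)) ≃ U(1) × ℤ₂³`. -/
def circleEquiv : H2 twist Circle ≃ₜ* Circle × Z2 × Z2 × Z2 where
  toMulEquiv := (QuotientGroup.quotientMulEquivOfEq ker_circleInvariants.symm).trans
    (QuotientGroup.quotientKerEquivOfSurjective circleInvariants
      (Function.RightInverse.surjective circleInvariants_circleFactorSet))
  continuous_toFun := continuous_coinduced_dom.2 continuous_circleInvariants
  continuous_invFun := by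
    -- The inverse is induced by the continuous choice of factor sets `circleFactorSet`.
    have h (v : Circle × Z2 × Z2 × Z2) : ((QuotientGroup.quotientMulEquivOfEq
        ker_circleInvariants.symm).trans (QuotientGroup.quotientKerEquivOfSurjective
        circleInvariants (Function.RightInverse.surjective
          circleInvariants_circleFactorSet))).symm v = cls (circleFactorSet v) := by
      rw [MulEquiv.symm_apply_eq]
      exact (circleInvariants_circleFactorSet v).symm
    exact (continuous_quotient_mk'.comp continuous_circleFactorSet).congr fun v => (h v).symm

theorem circleEquiv_rho2 (c : H2 (1 : P4mm →* ℤˣ) Z2) : circleEquiv (rho2 twist c) =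
    ((signEquiv c .txty : Circle), signEquiv c .px, signEquiv c .txpx, signEquiv c .pxy) := by
  induction c using QuotientGroup.induction_on with
  | H ω => exact circleInvariants_inclZ2 ω

/-! ### Anomaly-negative classes -/

/-- An integral twisted factor set `f` passes the anomaly test after reduction modulo `2`: if
`ζ ^ n = u` is a sign, `ζ ^ f` has values in the `2n`-th roots of unity. -/
theorem signFactorSet_mem_anomalyNegativeFactorSets {f : P4mm → P4mm → ℤ} (hf : IsIntFactorSet f)
    (u : Z2) : signFactorSet hf.isModTwoFactorSet u ∈ anomalyNegativeFactorSets twist := by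
  intro n hn _
  obtain ⟨ζ, hζ⟩ := Circle.exists_pow_eq (n := n) (by omega) (u : Circle)
  have hζ' : ζ ∈ Zmod (2 * n) := by
    change ζ ^ (2 * n) = 1
    rw [mul_comm, pow_mul, hζ]
    exact u.2
  refine ⟨powFactorSet _ hf ⟨ζ, hζ'⟩, fun p => ?_⟩
  change (u : Circle) ^ f p.1 p.2 = (ζ ^ f p.1 p.2) ^ n
  rw [← hζ, ← zpow_natCast, ← zpow_natCast, ← zpow_mul, ← zpow_mul, mul_comm]

open Classical in
theorem mem_anomalyNegative_iff (c : H2 (1 : P4mm →* ℤˣ) Z2) : c ∈ anomalyNegative twist ↔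
    signEquiv c .px = 1 ∧ signEquiv c .txpx = 1 ∧ signEquiv c .pxy = 1 := by
  constructor
  · rintro ⟨ω, hω, rfl⟩
    obtain ⟨φ, hφ⟩ := hω 2 le_rfl even_two
    -- The case `n = 2` suffices: the three signs of `ω` are the squares of those of `φ`.
    let ψ : factorSets twist Circle := ⟨fun p => φ.1 p, mem_factorSets.2 fun g h k =>
      congrArg Subtype.val (mem_factorSets.1 φ.2 g h k)⟩
    have hψ : inclZ2 twist ω = ψ ^ 2 := Subtype.ext (funext hφ)
    have h := circleInvariants_inclZ2 ω
    rw [hψ, map_pow] at h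
    simp only [Prod.ext_iff, Prod.pow_fst, Prod.pow_snd, Z2.sq_eq_one] at h
    exact ⟨h.2.1.symm, h.2.2.1.symm, h.2.2.2.symm⟩
  · rintro ⟨h1, h2, h3⟩
    refine ⟨signFactorSet (isModTwoFactorSet_relExp .txty) (signEquiv c .txty) *
      signFactorSet (isModTwoFactorSet_relExp .typx) (signEquiv c .typx) *
      signFactorSet (isModTwoFactorSet_relExp .pxpxy) (signEquiv c .pxpxy),
      mul_mem (mul_mem ?_ ?_) ?_, signEquiv.injective ?_⟩
    · exact signFactorSet_mem_anomalyNegativeFactorSets isIntFactorSet_fluxExp _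
    · exact signFactorSet_mem_anomalyNegativeFactorSets isIntFactorSet_halfTransExp _
    · exact signFactorSet_mem_anomalyNegativeFactorSets isIntFactorSet_quarterTurnExp _
    · rw [signEquiv_cls, map_mul, map_mul, signInvariants_relExp, signInvariants_relExp,
        signInvariants_relExp]
      funext r
      cases r <;> simp [h1, h2, h3]

instance Z2.finite : Finite Z2 := by
  refine Finite.of_injective (fun u : Z2 => (u : Circle) = 1) fun u v h => Subtype.ext ?_
  have h' (w : Z2) : (w : Circle) = 1 ∨ (w : Circle) = -1 := by
    have hw : ((w : Circle) : ℂ) ^ 2 = 1 := by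
      exact_mod_cast congrArg (Subtype.val : Circle → ℂ) (show (w : Circle) ^ 2 = 1 from w.2)
    exact (mul_self_eq_one_iff.1 ((sq _).symm.trans hw)).imp Circle.ext fun h => Circle.ext h
  have h1 : ((u : Circle) = 1) = ((v : Circle) = 1) := h
  rcases h' u with hu | hu <;> rcases h' v with hv | hv <;> rw [hu, hv] at h1 ⊢ <;> simp_all

/-- The identity component of `U(1) × ℤ₂³` is `U(1)`. -/
theorem mem_connectedComponent_one_iff (x : H2 twist Circle) :
    x ∈ connectedComponent (1 : H2 twist Circle) ↔ (circleEquiv x).2 = 1 := by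
  constructor
  · intro hx
    have hc : Continuous fun y : H2 twist Circle => (circleEquiv y).2 :=
      continuous_snd.comp circleEquiv.continuous_toFun
    have h := (isPreconnected_connectedComponent (x := (1 : H2 twist Circle))).image _
      hc.continuousOn
    rw [h.subsingleton (Set.mem_image_of_mem _ hx) (Set.mem_image_of_mem _ mem_connectedComponent),
      map_one]
    rfl
  · intro hx
    have hc : Continuous fun a : Circle => circleEquiv.symm (a, 1) :=
      circleEquiv.symm.continuous_toFun.comp (Continuous.prodMk_left 1)
    refine (isPreconnected_range hc).subset_connectedComponent ⟨1, ?_⟩ ⟨(circleEquiv x).1, ?_⟩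
    · exact map_one circleEquiv.symm
    · rw [← hx]
      exact circleEquiv.symm_apply_apply x

/-- The coordinates `(σ_px, σ_txpx, σ_pxy)`, whose kernel is the group of anomaly-negative
classes. -/
def anomalyHom : H2 (1 : P4mm →* ℤˣ) Z2 →* Z2 × Z2 × Z2 :=
  MonoidHom.comp ((Pi.evalMonoidHom _ Rel.px).prod ((Pi.evalMonoidHom _ Rel.txpx).prod
    (Pi.evalMonoidHom _ Rel.pxy))) signEquiv.toMonoidHom

theorem anomalyHom_apply (c : H2 (1 : P4mm →* ℤˣ) Z2) :
    anomalyHom c = (signEquiv c .px, signEquiv c .txpx, signEquiv c .pxy) := rfl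

theorem ker_anomalyHom : anomalyHom.ker = anomalyNegative twist := by
  ext c
  rw [MonoidHom.mem_ker, mem_anomalyNegative_iff, anomalyHom_apply]
  simp only [Prod.ext_iff, Prod.fst_one, Prod.snd_one]

theorem anomalyHom_surjective : Function.Surjective anomalyHom := by
  intro v
  refine ⟨signEquiv.symm fun
    | .px => v.1
    | .txpx => v.2.1
    | .pxy => v.2.2
    | _ => 1, ?_⟩
  rw [anomalyHom_apply, MulEquiv.apply_symm_apply]

/-- The coordinates `(σ_txty, σ_typx, σ_pxpxy)` on the group of anomaly-negative classes. -/
def anomalyNegativeHom : anomalyNegative twist →* Z2 × Z2 × Z2 :=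
  (MonoidHom.comp ((Pi.evalMonoidHom _ Rel.txty).prod ((Pi.evalMonoidHom _ Rel.typx).prod
    (Pi.evalMonoidHom _ Rel.pxpxy))) signEquiv.toMonoidHom).comp (Subgroup.subtype _)

theorem anomalyNegativeHom_apply (c : anomalyNegative twist) : anomalyNegativeHom c =
    (signEquiv c.1 .txty, signEquiv c.1 .typx, signEquiv c.1 .pxpxy) := rfl

theorem anomalyNegativeHom_bijective : Function.Bijective anomalyNegativeHom := by
  constructor
  · rintro ⟨c, hc⟩ ⟨d, hd⟩ h
    obtain ⟨h1, h2, h3⟩ := (mem_anomalyNegative_iff c).1 hc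
    obtain ⟨k1, k2, k3⟩ := (mem_anomalyNegative_iff d).1 hd
    simp only [anomalyNegativeHom_apply, Prod.ext_iff] at h
    refine Subtype.ext (signEquiv.injective (funext fun r => ?_))
    cases r
    · exact h.1
    · exact h.2.1
    · exact h1.trans k1.symm
    · exact h2.trans k2.symm
    · exact h3.trans k3.symm
    · exact h.2.2
  · intro v
    refine ⟨⟨signEquiv.symm fun
      | .txty => v.1
      | .typx => v.2.1
      | .pxpxy => v.2.2
      | _ => 1, (mem_anomalyNegative_iff _).2 ?_⟩, ?_⟩
    · rw [MulEquiv.apply_symm_apply]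
      exact ⟨rfl, rfl, rfl⟩
    · rw [anomalyNegativeHom_apply, MulEquiv.apply_symm_apply]

end P4mm

end

end FluxFusion

open FluxFusion in
theorem mainTheorem6 :
    ∃ (σ : H2 (1 : P4mm →* ℤˣ) Z2 ≃* (P4mm.Rel → Z2))
      (α : H2 P4mm.twist Circle ≃ₜ* Circle × Z2 × Z2 × Z2),
      (∀ (ω : factorSets (1 : P4mm →* ℤˣ) Z2) (s : P4mm.Rel → Z2),
        P4mm.HasRelations ω s ↔ σ (cls ω) = s) ∧
      (∀ (ω : factorSets P4mm.twist Circle) (a : Circle) (p q r : Z2),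
        P4mm.HasRelations ω (P4mm.canonical a p q r) ↔ α (cls ω) = (a, p, q, r)) ∧
      (∀ c : H2 (1 : P4mm →* ℤˣ) Z2,
        α (rho2 P4mm.twist c) = ((σ c .txty : Circle), σ c .px, σ c .txpx, σ c .pxy)) ∧
      (∀ c : H2 (1 : P4mm →* ℤˣ) Z2,
        c ∈ anomalyNegative P4mm.twist ↔ σ c .px = 1 ∧ σ c .txpx = 1 ∧ σ c .pxy = 1) ∧
      (∀ c : H2 (1 : P4mm →* ℤˣ) Z2, c ∈ anomalyNegative P4mm.twist ↔
        rho2 P4mm.twist c ∈ connectedComponent (1 : H2 P4mm.twist Circle)) ∧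
      Nonempty (anomalyNegative P4mm.twist ≃* Z2 × Z2 × Z2) ∧
      Nonempty (H2 (1 : P4mm →* ℤˣ) Z2 ⧸ anomalyNegative P4mm.twist ≃* Z2 × Z2 × Z2) := by
  refine ⟨P4mm.signEquiv, P4mm.circleEquiv, P4mm.hasRelations_iff_signInvariants,
    P4mm.hasRelations_canonical_iff, P4mm.circleEquiv_rho2, P4mm.mem_anomalyNegative_iff,
    fun c => ?_, ⟨MulEquiv.ofBijective _ P4mm.anomalyNegativeHom_bijective⟩,
    ⟨(QuotientGroup.quotientMulEquivOfEq P4mm.ker_anomalyHom.symm).trans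
      (QuotientGroup.quotientKerEquivOfSurjective _ P4mm.anomalyHom_surjective)⟩⟩
  rw [P4mm.mem_connectedComponent_one_iff, P4mm.circleEquiv_rho2, P4mm.mem_anomalyNegative_iff]
  simp only [Prod.ext_iff, Prod.fst_one, Prod.snd_one]
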